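/- Let $(\Omega,\mathcal B)$ be a measurable space. A $\sigma$-finite signed measure on $(\Omega,\mathcal B)$ is a countably additive extended real valued function $\nu$ on $\mathcal B$ with $\nu(\emptyset)=0$ that takes at most one of the values $+\infty,-\infty$ and whose total variation $|\nu|$ is $\sigma$-finite. Let $\mu$ be a positive $\sigma$-finite measure on $(\Omega,\mathcal B)$ whose range $\{\mu(A):A\in\mathcal B\}\subseteq[0,\infty]$ is an interval, and let $\nu$ be a $\sigma$-finite signed measure on $(\Omega,\mathcal B)$ satisfying (L) for all $A,B\in\mathcal B$ with $\mu(A)=\mu(B)\neq\infty$, one has $\nu(A)=\nu(B)\neq\pm\infty$. Suppose that $\nu$ is positive, or that there exist $\varepsilon>0$ and $M<\infty$ such that $\frac{|\nu(A)|}{\mu(A)}<M$ for all $A\in\mathcal B$ with $0<\mu(A)<\varepsilon$. Then $\nu$ is a constant multiple of $\mu$: there is $\alpha\in\mathbb R$ with $\nu(A)=\alpha\,\mu(A)$ for all $A\in\mathcal B$ (with the convention $0\cdot\infty=0$). -/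

import Mathlib

open MeasureTheory
open scoped ENNReal NNReal

/-- Total variation of an extended real valued set function on a set `E`: the supremum of the sums
`∑ |ν S|` over finite families of pairwise disjoint measurable subsets `S` of `E`. -/
noncomputable def signedTotalVariation {Ω : Type*} [MeasurableSpace Ω]
    (ν : VectorMeasure Ω EReal) (E : Set Ω) : ℝ≥0∞ :=
  ⨆ (P : Finset (Set Ω)) (_ : ∀ S ∈ P, MeasurableSet S ∧ S ⊆ E)
    (_ : (P : Set (Set Ω)).PairwiseDisjoint id), ∑ S ∈ P, (ν S).abs

/-- A `σ`-finite signed measure: a countably additive extended real valued set function that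
takes at most one of the two values `+∞`, `-∞`, and whose total variation is `σ`-finite. -/
structure IsSigmaFiniteSignedMeasure {Ω : Type*} [MeasurableSpace Ω]
    (ν : VectorMeasure Ω EReal) : Prop where
  one_infinite_value :
    (∀ A, MeasurableSet A → ν A ≠ ⊤) ∨ (∀ A, MeasurableSet A → ν A ≠ ⊥)
  sigma_finite : ∃ S : ℕ → Set Ω,
    (∀ n, MeasurableSet (S n)) ∧ (∀ n, signedTotalVariation ν (S n) < ∞) ∧ ⋃ n, S n = Set.univ

/-- The range of a positive measure, as a subset of `[0, ∞]`. -/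
def measureRange {Ω : Type*} [MeasurableSpace Ω] (μ : Measure Ω) : Set ℝ≥0∞ :=
  {t | ∃ A, MeasurableSet A ∧ μ A = t}

/-- Condition `(L)`: measurable sets of equal finite `μ`-measure have equal finite
`ν`-measure. -/
def ConditionL {Ω : Type*} [MeasurableSpace Ω] (μ : Measure Ω)
    (ν : VectorMeasure Ω EReal) : Prop :=
  ∀ A B, MeasurableSet A → MeasurableSet B → μ A = μ B → μ A ≠ ∞ →
    ν A = ν B ∧ ν A ≠ ⊤ ∧ ν A ≠ ⊥

/-! On sets of finite measure, (L) makes `ν` a function of the number `μ A`. Since `μ` may have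
atoms, sets need not split into pieces of prescribed measure, so Cauchy's functional equation is not
directly available.

A substitute is a decreasing tower `D n` with measures tending to zero, whose layers `D n \ D (n +
1)` have measures `x n`, each at most the sum of the later ones (`exists_fillingTower`). The subsums
of such a sequence fill an interval. Either alternative hypothesis makes some `ν + c μ` nonnegative
on small sets, so its values `y n` on the layers of a small tower are nonnegative, and by (L) each
subsum of `y` is determined by that of `x`. This dependence is monotone, hence differentiable
somewhere; `y n / x n` tends to the derivative `α`, and writing each `x n` through later terms
forces `y n = α * x n` (`exists_eq_mul_of_subsum_congr`). So a charge `g`, equal to `ν` up to a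
multiple of `μ`, vanishes on all sets of measure at most `μ (D 0)` (`exists_isZeroFilling`).

`IsZeroFilling.eq_zero` propagates this to every finite measure. Take a maximal set `G` below whose
measure `τ` the charge vanishes. If the process stops early, non-null sets off `G` have measure
above `τ`, yet the interval range provides some with measure as close to `τ` as desired. A measure
between `2τ` and `3τ` is then reached both with two such sets and with one, up to parts of `G`;
hence `g` vanishes on them too, and they generate all finite measures. Sets of infinite measure
follow by σ-finiteness. -/

open Filter Topology

/-! ### Interval filling sequences and their subsums. -/

/-- The sum of the terms of `x` with index in `A`. -/
noncomputable def subsum (x : ℕ → ℝ) (A : Set ℕ) : ℝ := ∑' n, A.indicator x n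

/-- The sum of the terms of `x` with index at least `n`. -/
noncomputable def tailSum (x : ℕ → ℝ) (n : ℕ) : ℝ := ∑' k, x (k + n)

section subsum

variable {x : ℕ → ℝ}

lemma tailSum_eq (hx : Summable x) (n : ℕ) : tailSum x n = x n + tailSum x (n + 1) := by
  have h := ((summable_nat_add_iff n).2 hx).tsum_eq_zero_add
  simp only [zero_add] at h
  unfold tailSum
  rw [h]
  congr 2
  ext k
  congr 1
  ring

lemma tailSum_nonneg (h0 : ∀ n, 0 ≤ x n) (n : ℕ) : 0 ≤ tailSum x n :=
  tsum_nonneg fun _ => h0 _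

lemma tailSum_antitone (hx : Summable x) (h0 : ∀ n, 0 ≤ x n) : Antitone (tailSum x) :=
  antitone_nat_of_succ_le fun n => by rw [tailSum_eq hx n]; linarith [h0 n]

lemma tendsto_tailSum (x : ℕ → ℝ) : Tendsto (tailSum x) atTop (𝓝 0) :=
  tendsto_sum_nat_add x

lemma subsum_nonneg (h0 : ∀ n, 0 ≤ x n) (A : Set ℕ) : 0 ≤ subsum x A :=
  tsum_nonneg fun _ => Set.indicator_nonneg (fun _ _ => h0 _) _

lemma subsum_le_tailSum (hx : Summable x) (h0 : ∀ n, 0 ≤ x n) {n : ℕ} {A : Set ℕ}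
    (hA : A ⊆ Set.Ici n) : subsum x A ≤ tailSum x n := by
  unfold subsum tailSum
  rw [← (hx.indicator A).sum_add_tsum_nat_add n, Finset.sum_eq_zero, zero_add]
  · exact ((summable_nat_add_iff n).2 (hx.indicator A)).tsum_le_tsum
      (fun k => Set.indicator_le_self' (fun _ _ => h0 _) _) ((summable_nat_add_iff n).2 hx)
  · intro i hi
    refine Set.indicator_of_notMem (fun h => ?_) _
    exact absurd (hA h) (by simpa using hi)

lemma subsum_insert (hx : Summable x) {n : ℕ} {A : Set ℕ} (hn : n ∉ A) :
    subsum x (insert n A) = x n + subsum x A := by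
  unfold subsum
  have h : (insert n A).indicator x = fun k => ({n} : Set ℕ).indicator x k + A.indicator x k := by
    rw [Set.insert_eq, Set.indicator_union_of_disjoint (by simpa using hn)]
  rw [h, (hx.indicator _).tsum_add (hx.indicator _)]
  congr 1
  rw [tsum_eq_single n (fun m hm => by simp [hm])]
  simp

lemma subsum_singleton (n : ℕ) : subsum x {n} = x n := by
  unfold subsum
  rw [tsum_eq_single n (fun m hm => by simp [hm])]
  simp

lemma subsum_sub_singleton (hx : Summable x) {n : ℕ} {A : Set ℕ} (hn : n ∈ A) :
    subsum x (A \ {n}) = subsum x A - x n := by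
  have h := subsum_insert hx (A := A \ {n}) (n := n) (by simp)
  rw [Set.insert_sdiff_singleton, Set.insert_eq_of_mem hn] at h
  linarith

/-- A sequence each of whose terms is at most the sum of the later ones is interval filling. -/
lemma exists_subsum_eq (hx : Summable x) (h0 : ∀ n, 0 ≤ x n)
    (hfill : ∀ n, x n ≤ tailSum x (n + 1)) {n : ℕ} {t : ℝ} (ht0 : 0 ≤ t) (ht : t ≤ tailSum x n) :
    ∃ A ⊆ Set.Ici n, subsum x A = t := by
  classical
  -- Lazy greedy expansion: `r k` is what remains of `t`, and `x k` is taken only if the later terms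
  -- cannot cover the remainder. Hence no index below `n` is taken when `t ≤ tailSum x n`.
  let r : ℕ → ℝ := fun k =>
    Nat.rec (motive := fun _ => ℝ) t (fun k s => if tailSum x (k + 1) < s then s - x k else s) k
  have r0 : r 0 = t := rfl
  have rs : ∀ k, r (k + 1) = if tailSum x (k + 1) < r k then r k - x k else r k := fun _ => rfl
  have hanti := tailSum_antitone hx h0
  have hr : ∀ k, 0 ≤ r k ∧ r k ≤ tailSum x k := by
    intro k
    induction k with
    | zero => exact ⟨ht0, ht.trans (hanti (Nat.zero_le n))⟩
    | succ k ih =>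
      rw [rs]
      have h1 := tailSum_eq hx k
      have h2 := hfill k
      split_ifs with h
      · constructor <;> linarith [ih.2]
      · exact ⟨ih.1, not_lt.1 h⟩
  have hrn : ∀ k ≤ n, r k = t := by
    intro k hk
    induction k with
    | zero => rfl
    | succ k ih =>
      have h1 := ih (by omega)
      rw [rs, h1, if_neg (not_lt.2 (ht.trans (hanti hk)))]
  let A : Set ℕ := {k | tailSum x (k + 1) < r k}
  refine ⟨A, fun k hk => ?_, ?_⟩
  · by_contra hkn
    have hkn : k < n := by simpa using hkn
    have hk : tailSum x (k + 1) < r k := hk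
    rw [hrn k hkn.le] at hk
    exact absurd (ht.trans (hanti hkn)) (not_le.2 hk)
  · have hsum : ∀ k, ∑ i ∈ Finset.range k, A.indicator x i = t - r k := by
      intro k
      induction k with
      | zero => simp [r0]
      | succ k ih =>
        rw [Finset.sum_range_succ, ih, rs]
        by_cases h : tailSum x (k + 1) < r k
        · rw [Set.indicator_of_mem (show k ∈ A from h), if_pos h]; ring
        · rw [Set.indicator_of_notMem (show k ∉ A from h), if_neg h]; ring
    have hlim : Tendsto r atTop (𝓝 0) :=
      squeeze_zero (fun k => (hr k).1) (fun k => (hr k).2) (tendsto_tailSum x)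
    refine ((hasSum_iff_tendsto_nat_of_nonneg
      (fun i => Set.indicator_nonneg (fun _ _ => h0 _) _) t).2 ?_).tsum_eq
    simp_rw [hsum]
    simpa using hlim.const_sub t

variable {y : ℕ → ℝ}

/-- If the subsums of a nonnegative sequence `y` only depend on those of an interval filling
sequence `x`, they depend on them monotonically. -/
lemma subsum_mono_of_subsum_congr (hx : Summable x) (hx0 : ∀ n, 0 ≤ x n)
    (hfill : ∀ n, x n ≤ tailSum x (n + 1)) (hy : Summable y) (hy0 : ∀ n, 0 ≤ y n)
    (hxy : ∀ A B, subsum x A = subsum x B → subsum y A = subsum y B) {A B : Set ℕ}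
    (hAB : subsum x A ≤ subsum x B) : subsum y A ≤ subsum y B := by
  -- Backward induction on `n` from `m`, with error `tailSum y m`. Both index sets are re-expanded
  -- beyond `n`, after splitting off `n` where needed; if only `B` uses `n`, an expansion `C` of `x
  -- n` beyond `n` serves as intermediary.
  have key : ∀ m n, n ≤ m → ∀ A B, A ⊆ Set.Ici n → B ⊆ Set.Ici n → subsum x A ≤ subsum x B →
      subsum y A ≤ subsum y B + tailSum y m := by
    intro m n hn
    induction hn using Nat.decreasingInduction with
    | self =>
      intro A B hA _ _
      linarith [subsum_le_tailSum hy hy0 hA, subsum_nonneg hy0 B]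
    | of_succ n hn ih =>
      intro A B hA hB hAB
      have hsA := subsum_nonneg hx0 A
      have hrep := fun {t : ℝ} => exists_subsum_eq hx hx0 hfill (n := n + 1) (t := t)
      have hXn := tailSum_eq hx n
      have hins : ∀ C ⊆ Set.Ici (n + 1), n ∉ C := fun C hC h => by simpa using hC h
      have hbig : ∀ C, C ⊆ Set.Ici n → x n ≤ subsum x C → ∃ C' ⊆ Set.Ici (n + 1),
          subsum x C = x n + subsum x C' ∧ subsum y C = y n + subsum y C' := by
        intro C hC h
        have := subsum_le_tailSum hx hx0 hC
        obtain ⟨C', hC', e⟩ := hrep (t := subsum x C - x n) (by linarith) (by linarith)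
        refine ⟨C', hC', by linarith, ?_⟩
        rw [← subsum_insert hy (hins C' hC')]
        refine hxy _ _ ?_
        rw [subsum_insert hx (hins C' hC'), e]
        ring
      by_cases hB' : subsum x B ≤ tailSum x (n + 1)
      · obtain ⟨A', hA', eA⟩ := hrep hsA (hAB.trans hB')
        obtain ⟨B', hB'', eB⟩ := hrep (hsA.trans hAB) hB'
        rw [← hxy _ _ eA, ← hxy _ _ eB]
        exact ih A' B' hA' hB'' (by rw [eA, eB]; exact hAB)
      · have hB' := not_le.1 hB'
        obtain ⟨B', hB'', eB, eB'⟩ := hbig B hB ((hfill n).trans hB'.le)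
        by_cases hA' : x n ≤ subsum x A
        · obtain ⟨A', hA'', eA, eA'⟩ := hbig A hA hA'
          have := ih A' B' hA'' hB'' (by linarith)
          linarith
        · have hA' := not_le.1 hA'
          obtain ⟨A', hA'', eA⟩ := hrep hsA (hA'.le.trans (hfill n))
          obtain ⟨C, hC, eC⟩ := hrep (hx0 n) (hfill n)
          have h1 := ih A' C hA'' hC (by linarith)
          have h2 := hxy C {n} (by rw [eC, subsum_singleton])
          rw [subsum_singleton] at h2
          rw [hxy _ _ eA] at h1
          linarith [subsum_nonneg hy0 B']
  refine ge_of_tendsto' (x := atTop) (f := fun m => subsum y B + tailSum y m) ?_ fun m =>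
    key m 0 (Nat.zero_le m) A B (fun _ _ => Nat.zero_le _) (fun _ _ => Nat.zero_le _) hAB
  simpa using (tendsto_tailSum y).const_add (subsum y B)

/-- The map `f` from subsums of `x` to subsums of `y` is monotone, so it is differentiable at some
interior `t = subsum x B`. Toggling the index `n` in `B` moves `t` by `± x n` and `f t` by `± y n`,
so `y n / x n` is a difference quotient at `t`. -/
lemma exists_tendsto_ratio (hx : Summable x) (hx0 : ∀ n, 0 < x n)
    (hfill : ∀ n, x n ≤ tailSum x (n + 1)) (hy : Summable y) (hy0 : ∀ n, 0 ≤ y n)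
    (hxy : ∀ A B, subsum x A = subsum x B → subsum y A = subsum y B) :
    ∃ α, Tendsto (fun n => y n / x n) atTop (𝓝 α) := by
  have hx0' := fun n => (hx0 n).le
  have hrep : ∀ t : Set.Icc 0 (tailSum x 0), ∃ A, subsum x A = t := fun t =>
    (exists_subsum_eq hx hx0' hfill t.2.1 t.2.2).imp fun A h => h.2
  choose A hA using hrep
  classical
  let f : ℝ → ℝ := fun t => if h : t ∈ Set.Icc 0 (tailSum x 0) then subsum y (A ⟨t, h⟩) else 0
  have hmem : ∀ B, subsum x B ∈ Set.Icc 0 (tailSum x 0) := fun B =>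
    ⟨subsum_nonneg hx0' B, subsum_le_tailSum hx hx0' fun _ _ => Nat.zero_le _⟩
  have hf : ∀ B, f (subsum x B) = subsum y B := by
    intro B
    simp only [f, dif_pos (hmem B)]
    exact hxy _ _ (hA _)
  have hmono : MonotoneOn f (Set.Icc 0 (tailSum x 0)) := by
    intro s hs t ht hst
    have h := subsum_mono_of_subsum_congr hx hx0' hfill hy hy0 hxy
      (A := A ⟨s, hs⟩) (B := A ⟨t, ht⟩) (by rwa [hA, hA])
    rwa [← hf, ← hf, hA, hA] at h
  have hpos : 0 < tailSum x 0 := by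
    rw [tailSum_eq hx]
    linarith [hx0 0, tailSum_nonneg hx0' 1]
  obtain ⟨t, ht, hd⟩ : ∃ t ∈ Set.Ioo 0 (tailSum x 0), DifferentiableAt ℝ f t := by
    by_contra! hcon
    have hae := hmono.ae_differentiableWithinAt_of_mem
    have hz : volume (Set.Ioo 0 (tailSum x 0)) = 0 := by
      refine measure_mono_null (fun t ht => ?_) (ae_iff.1 hae)
      intro hd
      exact hcon t ht ((hd (Set.Ioo_subset_Icc_self ht)).differentiableAt
        (Icc_mem_nhds ht.1 ht.2))
    rw [Real.volume_Ioo] at hz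
    simp at hz
    linarith
  have htI := Set.Ioo_subset_Icc_self ht
  set B := A ⟨t, htI⟩ with hB
  have htB : subsum x B = t := hA ⟨t, htI⟩
  refine ⟨deriv f t, ?_⟩
  have hslope := hasDerivAt_iff_tendsto_slope.1 hd.hasDerivAt
  let u : ℕ → ℝ := fun n => if n ∈ B then t - x n else t + x n
  have hu : Tendsto u atTop (𝓝[≠] t) := by
    have hx1 := hx.tendsto_atTop_zero
    refine tendsto_nhdsWithin_iff.2 ⟨?_, Eventually.of_forall fun n => ?_⟩
    · have h1 : Tendsto (fun n => t - x n) atTop (𝓝 t) := by simpa using hx1.const_sub t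
      have h2 : Tendsto (fun n => t + x n) atTop (𝓝 t) := by simpa using hx1.const_add t
      exact h1.if' h2
    · have := hx0 n
      simp only [u]
      split_ifs <;> simp [this.ne']
  refine (hslope.comp hu).congr fun n => ?_
  have hn := (hx0 n).ne'
  simp only [Function.comp, slope_def_field, u]
  split_ifs with h
  · rw [← htB, ← subsum_sub_singleton hx h, hf, hf, subsum_sub_singleton hx h,
      subsum_sub_singleton hy h, eq_div_iff hn, sub_sub_cancel_left, sub_sub_cancel_left,
      neg_div_neg_eq, div_mul_cancel₀ _ hn]
  · rw [← htB, add_comm, ← subsum_insert hx h, hf, hf, subsum_insert hx h, subsum_insert hy h,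
      add_sub_cancel_right, add_sub_cancel_right]

lemma subsum_sub_mul (hx : Summable x) (hy : Summable y) (α : ℝ) (A : Set ℕ) :
    subsum (fun n => y n - α * x n) A = subsum y A - α * subsum x A := by
  unfold subsum
  rw [← tsum_mul_left, ← (hy.indicator A).tsum_sub ((hx.indicator A).mul_left α)]
  congr 1
  ext n
  by_cases h : n ∈ A <;> simp [h]

/-- A nonnegative sequence whose subsums only depend on those of an interval filling sequence is
proportional to that sequence. -/
theorem exists_eq_mul_of_subsum_congr (hx : Summable x) (hx0 : ∀ n, 0 < x n)
    (hfill : ∀ n, x n ≤ tailSum x (n + 1)) (hy : Summable y) (hy0 : ∀ n, 0 ≤ y n)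
    (hxy : ∀ A B, subsum x A = subsum x B → subsum y A = subsum y B) :
    ∃ α, ∀ n, y n = α * x n := by
  obtain ⟨α, hα⟩ := exists_tendsto_ratio hx hx0 hfill hy hy0 hxy
  refine ⟨α, fun n => ?_⟩
  have hx0' := fun n => (hx0 n).le
  have key : ∀ η > 0, |y n - α * x n| ≤ η * x n := by
    intro η hη
    obtain ⟨N, hN⟩ := Metric.tendsto_atTop.1 hα η hη
    have hlarge : ∀ k, N ≤ k → |y k - α * x k| ≤ η * x k := by
      intro k hk
      have h := (hN k hk).le
      have hk0 := hx0 k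
      rw [Real.dist_eq] at h
      calc |y k - α * x k| = |y k / x k - α| * x k := by
            rw [← abs_of_pos hk0, ← abs_mul, abs_of_pos hk0]
            congr 1
            field_simp
        _ ≤ η * x k := by gcongr
    -- The bound descends from large indices: `x k` is a subsum over later indices, `y k` is the
    -- matching subsum, and the termwise bounds add up to `η * x k`.
    have hall : ∀ k, k ≤ max n N → ∀ j, k ≤ j → |y j - α * x j| ≤ η * x j := by
      intro k hk
      induction hk using Nat.decreasingInduction with
      | self => exact fun j hj => hlarge j ((le_max_right _ _).trans hj)
      | of_succ k hk ih =>
        intro j hj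
        rcases hj.eq_or_lt with rfl | hj
        · obtain ⟨C, hC, e⟩ := exists_subsum_eq hx hx0' hfill (hx0' k) (hfill k)
          have e' := hxy C {k} (by rw [e, subsum_singleton])
          rw [subsum_singleton] at e'
          have hz : Summable fun n => y n - α * x n := hy.sub (hx.mul_left α)
          have h1 : y k - α * x k = subsum (fun n => y n - α * x n) C := by
            rw [subsum_sub_mul hx hy, e, e']
          have h2 : η * x k = ∑' n, η * C.indicator x n := by
            rw [tsum_mul_left, ← e]; rfl
          rw [h1, h2, ← Real.norm_eq_abs]
          refine tsum_of_norm_bounded ((hx.indicator C).mul_left η).hasSum fun i => ?_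
          by_cases hi : i ∈ C
          · simpa [hi] using ih i (hC hi)
          · simp [hi]
        · exact ih j hj
    exact hall n (le_max_left _ _) n le_rfl
  have h0 : |y n - α * x n| ≤ 0 := by
    refine le_of_forall_pos_le_add fun δ hδ => ?_
    have h := key (δ / x n) (div_pos hδ (hx0 n))
    rwa [div_mul_cancel₀ _ (hx0 n).ne', ← zero_add δ] at h
  linarith [abs_eq_zero.1 (le_antisymm h0 (abs_nonneg _))]

end subsum

/-! ### Construction of a filling tower. -/

section Tower

variable {Ω : Type*} [MeasurableSpace Ω] {μ : Measure Ω}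

lemma exists_measure_eq (hμ : (measureRange μ).OrdConnected) {s : ℝ≥0∞} (hs : s ≤ μ Set.univ) :
    ∃ A, MeasurableSet A ∧ μ A = s :=
  hμ.out ⟨∅, .empty, measure_empty⟩ ⟨Set.univ, .univ, rfl⟩ ⟨zero_le, hs⟩

/-- A family of sets closed under unions has an increasing sequence whose union realises the
supremum of the measures. -/
lemma exists_iUnion_eq_sSup (μ : Measure Ω) {F : Set (Set Ω)} (hne : F.Nonempty)
    (hU : ∀ A ∈ F, ∀ B ∈ F, A ∪ B ∈ F) :
    ∃ U : ℕ → Set Ω, Monotone U ∧ (∀ n, U n ∈ F) ∧ μ (⋃ n, U n) = sSup (μ '' F) := by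
  obtain ⟨u, -, hu, huF⟩ := exists_seq_tendsto_sSup (hne.image μ) (OrderTop.bddAbove _)
  choose V hVF hV using huF
  have hUF : ∀ n, partialSups V n ∈ F := by
    intro n
    induction n with
    | zero => simpa using hVF 0
    | succ n ih =>
      rw [partialSups_add_one]
      exact hU _ ih _ (hVF _)
  refine ⟨partialSups V, (partialSups V).monotone, hUF, le_antisymm ?_ ?_⟩
  · rw [(partialSups V).monotone.measure_iUnion]
    exact iSup_le fun n => le_sSup ⟨_, hUF n, rfl⟩
  · refine le_of_tendsto' hu fun n => ?_
    rw [← hV]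
    exact measure_mono ((le_partialSups V n).trans (Set.subset_iUnion (partialSups V) n))

/-- A decreasing sequence of sets with measures tending to zero, such that the differences of
consecutive sets are non null and have at most half of the measure. -/
structure IsFillingTower (μ : Measure Ω) (D : ℕ → Set Ω) : Prop where
  measurableSet : ∀ n, MeasurableSet (D n)
  antitone : Antitone D
  ne_top : μ (D 0) ≠ ∞
  tendsto : Tendsto (fun n => μ (D n)) atTop (𝓝 0)
  pos : ∀ n, 0 < μ (D n \ D (n + 1))
  le : ∀ n, μ (D n \ D (n + 1)) ≤ μ (D (n + 1))

lemma IsFillingTower.shift {D : ℕ → Set Ω} (h : IsFillingTower μ D) (n : ℕ) :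
    IsFillingTower μ fun k => D (k + n) where
  measurableSet k := h.measurableSet _
  antitone i j hij := h.antitone (by omega)
  ne_top := ne_top_of_le_ne_top h.ne_top (measure_mono (h.antitone (Nat.zero_le _)))
  tendsto := h.tendsto.comp (tendsto_add_atTop_nat n)
  pos k := by
    rw [Nat.add_right_comm]; exact h.pos _
  le k := by
    rw [Nat.add_right_comm]; exact h.le _

lemma tendsto_measure_diff_iInter {D : ℕ → Set Ω} (hm : ∀ n, MeasurableSet (D n))
    (hD : Antitone D) (hfin : μ (D 0) ≠ ∞) :
    Tendsto (fun n => μ (D n \ ⋂ k, D k)) atTop (𝓝 0) := by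
  have h := tendsto_measure_iInter_atTop (μ := μ) (s := fun n => D n \ ⋂ k, D k)
    (fun n => ((hm n).diff (.iInter hm)).nullMeasurableSet)
    (fun i j hij => Set.sdiff_subset_sdiff_left (hD hij))
    ⟨0, ne_top_of_le_ne_top hfin (measure_mono Set.sdiff_subset)⟩
  have he : ⋂ n, (D n \ ⋂ k, D k) = ∅ := by
    ext x
    simp only [Set.mem_iInter, Set.mem_sdiff, Set.mem_empty_iff_false, iff_false]
    intro hx
    exact (hx 0).2 fun i => (hx i).1
  rwa [he, measure_empty] at h

lemma tendsto_measure_of_iInter_null {D : ℕ → Set Ω} (hm : ∀ n, MeasurableSet (D n))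
    (hD : Antitone D) (hfin : μ (D 0) ≠ ∞) (h0 : μ (⋂ k, D k) = 0) :
    Tendsto (fun n => μ (D n)) atTop (𝓝 0) := by
  rw [← h0]
  exact tendsto_measure_iInter_atTop (fun n => (hm n).nullMeasurableSet) hD ⟨0, hfin⟩

/-- Among the subsets with at most half the measure of `D`, one is chosen exceeding half the
supremum. This near-maximality makes the exhaustion below leave only a null set. -/
lemma exists_half_subset {D₀ : Set Ω} (hfin : μ D₀ ≠ ∞)
    (hna : ∀ E ⊆ D₀, MeasurableSet E → 0 < μ E → ∃ B ⊆ E, MeasurableSet B ∧ 0 < μ B ∧ μ B < μ E)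
    {D : Set Ω} (hDm : MeasurableSet D) (hD : D ⊆ D₀) (hpos : 0 < μ D) :
    ∃ E ⊆ D, MeasurableSet E ∧ 0 < μ E ∧ 2 * μ E ≤ μ D ∧
      ∀ E' ⊆ D, MeasurableSet E' → 2 * μ E' ≤ μ D → μ E' ≤ 2 * μ E := by
  let S : Set ℝ≥0∞ := {s | ∃ E ⊆ D, MeasurableSet E ∧ 2 * μ E ≤ μ D ∧ μ E = s}
  have hDfin : μ D ≠ ∞ := ne_top_of_le_ne_top hfin (measure_mono hD)
  have hS : ∀ s ∈ S, s ≤ μ D := by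
    rintro s ⟨E, hE, -, -, rfl⟩
    exact measure_mono hE
  obtain ⟨e, he, he0⟩ : ∃ e ∈ S, 0 < e := by
    obtain ⟨B, hBD, hBm, hB0, hB⟩ := hna D hD hDm hpos
    have hsum : μ B + μ (D \ B) = μ D := by
      rw [measure_add_sdiff hBm.nullMeasurableSet, Set.union_eq_self_of_subset_left hBD]
    rcases le_total (μ B) (μ (D \ B)) with h | h
    · refine ⟨μ B, ⟨B, hBD, hBm, ?_, rfl⟩, hB0⟩
      rw [two_mul, ← hsum]
      gcongr
    · refine ⟨μ (D \ B), ⟨D \ B, Set.sdiff_subset, hDm.diff hBm, ?_, rfl⟩, ?_⟩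
      · rw [two_mul, ← hsum]
        gcongr
      · refine pos_iff_ne_zero.2 fun h0 => ?_
        rw [h0, add_zero] at hsum
        exact hB.ne hsum
  have hσ0 : 0 < sSup S := he0.trans_le (le_sSup he)
  have hσ : sSup S ≠ ∞ := ne_top_of_le_ne_top hDfin (sSup_le hS)
  obtain ⟨s, ⟨E, hE, hEm, hE2, rfl⟩, hs⟩ := lt_sSup_iff.1 (ENNReal.half_lt_self hσ0.ne' hσ)
  refine ⟨E, hE, hEm, zero_le.trans_lt hs, hE2, fun E' hE' hE'm h' => ?_⟩
  calc μ E' ≤ sSup S := le_sSup ⟨E', hE', hE'm, h', rfl⟩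
    _ = 2 * (sSup S / 2) := (ENNReal.mul_div_cancel (by simp) (by simp)).symm
    _ ≤ 2 * μ E := by gcongr

/-- Near-maximal pieces of at most half measure are removed repeatedly. A non-null intersection
would contain a non-null `B` competing at every stage, so `μ B` would be at most twice the measures
of the removed pieces, which tend to zero. -/
lemma exists_fillingTower_of_atomless {D₀ : Set Ω} (hm : MeasurableSet D₀) (hpos : 0 < μ D₀)
    (hfin : μ D₀ ≠ ∞)
    (hna : ∀ E ⊆ D₀, MeasurableSet E → 0 < μ E →
      ∃ B ⊆ E, MeasurableSet B ∧ 0 < μ B ∧ μ B < μ E) :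
    ∃ D, IsFillingTower μ D := by
  have hstep := fun D : {D : Set Ω // MeasurableSet D ∧ D ⊆ D₀ ∧ 0 < μ D} =>
    exists_half_subset hfin hna D.2.1 D.2.2.1 D.2.2.2
  choose E hED hEm hE0 hE2 hEmax using hstep
  have hrest : ∀ D, μ (E D) ≤ μ (D.1 \ E D) := by
    intro D
    have hf : μ (E D) ≠ ∞ :=
      ne_top_of_le_ne_top hfin (measure_mono ((hED D).trans D.2.2.1))
    have h := hE2 D
    rw [← Set.union_sdiff_cancel (hED D), measure_union Set.disjoint_sdiff_right
      (D.2.1.diff (hEm D)), two_mul] at h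
    exact (ENNReal.add_le_add_iff_left hf).1 h
  let s : ℕ → {D : Set Ω // MeasurableSet D ∧ D ⊆ D₀ ∧ 0 < μ D} := fun n =>
    Nat.rec ⟨D₀, hm, subset_rfl, hpos⟩ (fun _ D => ⟨D.1 \ E D, D.2.1.diff (hEm D),
      Set.sdiff_subset.trans D.2.2.1, (hE0 D).trans_le (hrest D)⟩) n
  have hs : ∀ n, (s (n + 1)).1 = (s n).1 \ E (s n) := fun _ => rfl
  have hdiff : ∀ n, (s n).1 \ (s (n + 1)).1 = E (s n) := fun n => by
    rw [hs, Set.sdiff_sdiff_cancel_left (hED _)]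
  have hanti : Antitone fun n => (s n).1 :=
    antitone_nat_of_succ_le fun n => by rw [hs]; exact Set.sdiff_subset
  have hmeas : ∀ n, MeasurableSet (s n).1 := fun n => (s n).2.1
  refine ⟨fun n => (s n).1, hmeas, hanti, hfin, ?_, fun n => ?_, fun n => ?_⟩
  · refine tendsto_measure_of_iInter_null hmeas hanti hfin ?_
    by_contra h0
    have hpos' := pos_iff_ne_zero.2 h0
    have hsub : ∀ n, ⋂ k, (s k).1 ⊆ (s n).1 := fun n => Set.iInter_subset _ n
    obtain ⟨B, hB, hBm, hB0, hB2, -⟩ := exists_half_subset hfin hna (.iInter hmeas)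
      ((hsub 0).trans (s 0).2.2.1) hpos'
    have hle : ∀ n, μ B ≤ 2 * μ ((s n).1 \ ⋂ k, (s k).1) := by
      intro n
      refine (hEmax (s n) B (hB.trans (hsub n)) hBm
        (hB2.trans (measure_mono (hsub n)))).trans ?_
      gcongr
      rw [← hdiff n]
      exact Set.sdiff_subset_sdiff_right (hsub (n + 1))
    have hlim := ENNReal.Tendsto.const_mul (a := 2)
      (tendsto_measure_diff_iInter (μ := μ) hmeas hanti hfin) (Or.inr (by simp))
    rw [mul_zero] at hlim
    exact hB0.not_ge (ge_of_tendsto' hlim hle)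
  · rw [hdiff]; exact hE0 _
  · rw [hdiff, hs]; exact hrest _

/-- A non null set of finite measure without measurable subsets of intermediate measure. -/
structure IsMeasureAtom (μ : Measure Ω) (a : Set Ω) : Prop where
  measurableSet : MeasurableSet a
  pos : 0 < μ a
  ne_top : μ a ≠ ∞
  eq_zero_or_eq : ∀ B ⊆ a, MeasurableSet B → μ B = 0 ∨ μ B = μ a

lemma IsMeasureAtom.aedisjoint {a b : Set Ω} (ha : IsMeasureAtom μ a) (hb : IsMeasureAtom μ b)
    (hab : μ a ≠ μ b) : AEDisjoint μ a b := by
  have hm := ha.measurableSet.inter hb.measurableSet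
  rcases ha.eq_zero_or_eq _ Set.inter_subset_left hm with h | h
  · exact h
  rcases hb.eq_zero_or_eq _ Set.inter_subset_right hm with h' | h'
  · exact h'
  · exact absurd (h.symm.trans h') hab

/-- Atoms of distinct measures are almost disjoint, so in a set of finite measure only finitely many
atom sizes exceed a given one. -/
lemma exists_max_atom {D : Set Ω} (hfin : μ D ≠ ∞) (hex : ∃ a ⊆ D, IsMeasureAtom μ a) :
    ∃ a ⊆ D, IsMeasureAtom μ a ∧ ∀ b ⊆ D, IsMeasureAtom μ b → μ b ≤ μ a := by
  obtain ⟨a, haD, ha⟩ := hex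
  let S : Set ℝ≥0∞ := {s | ∃ b ⊆ D, IsMeasureAtom μ b ∧ μ b = s}
  have hS : ∀ s : S, ∃ b ⊆ D, IsMeasureAtom μ b ∧ μ b = s := fun s => s.2
  choose b hbD hb hbs using hS
  have hfinite : {s : S | μ a ≤ μ (b s)}.Finite := by
    refine Measure.finite_const_le_meas_of_disjoint_iUnion₀ μ ha.pos
      (fun s => (hb s).measurableSet.nullMeasurableSet) (fun s t hst => ?_)
      (ne_top_of_le_ne_top hfin (measure_mono (Set.iUnion_subset hbD)))
    refine (hb s).aedisjoint (hb t) fun h => hst ?_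
    rw [hbs, hbs] at h
    exact Subtype.ext h
  obtain ⟨m, hm, hmax⟩ := Set.exists_max_image _ (fun s : S => μ (b s)) hfinite
    ⟨⟨μ a, a, haD, ha, rfl⟩, (hbs _).ge⟩
  refine ⟨b m, hbD m, hb m, fun c hcD hc => ?_⟩
  rcases le_total (μ a) (μ c) with h | h
  · have := hmax ⟨μ c, c, hcD, hc, rfl⟩ (by simpa [hbs] using h)
    simpa [hbs] using this
  · exact h.trans hm

/-- Largest atoms are removed one after another. The invariant that sufficiently small sets lie
almost inside the remainder keeps the remainder non-null, so an atom is always left. -/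
lemma exists_fillingTower_of_atoms (hμ : (measureRange μ).OrdConnected) (hμ0 : 0 < μ Set.univ)
    (hat : ∀ E, MeasurableSet E → 0 < μ E → μ E ≠ ∞ → ∃ a ⊆ E, IsMeasureAtom μ a)
    {W : Set Ω} (hWm : MeasurableSet W) (hW : μ W ≠ ∞) {w : ℝ≥0∞} (hw : 0 < w)
    (hsmall : ∀ H, MeasurableSet H → μ H < w → μ (H \ W) = 0) :
    ∃ D, IsFillingTower μ D := by
  have hstep : ∀ D : {D : Set Ω // MeasurableSet D ∧ D ⊆ W ∧
      ∃ m > 0, ∀ H, MeasurableSet H → μ H < m → μ (H \ D) = 0},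
      ∃ a ⊆ D.1, IsMeasureAtom μ a ∧ ∀ b ⊆ D.1, IsMeasureAtom μ b → μ b ≤ μ a := by
    rintro ⟨D, hDm, hDW, m, hm, hmD⟩
    have hDfin : μ D ≠ ∞ := ne_top_of_le_ne_top hW (measure_mono hDW)
    refine exists_max_atom hDfin (hat D hDm ?_ hDfin)
    obtain ⟨s, hs0, hs⟩ := exists_between (lt_min hm hμ0)
    obtain ⟨H, hHm, rfl⟩ := exists_measure_eq hμ (hs.trans_le (min_le_right _ _)).le
    exact hs0.trans_le (measure_mono_ae (ae_le_set.2 (hmD H hHm (hs.trans_le (min_le_left _ _)))))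
  choose a haD ha hmax using hstep
  let s : ℕ → {D : Set Ω // MeasurableSet D ∧ D ⊆ W ∧
      ∃ m > 0, ∀ H, MeasurableSet H → μ H < m → μ (H \ D) = 0} := fun n =>
    Nat.rec ⟨W, hWm, subset_rfl, w, hw, hsmall⟩ (fun _ D => ⟨D.1 \ a D,
      D.2.1.diff (ha D).measurableSet, Set.sdiff_subset.trans D.2.2.1, by
        obtain ⟨m, hm, hmD⟩ := D.2.2.2
        refine ⟨min m (μ (a D)), lt_min hm (ha D).pos, fun H hHm hH => ?_⟩
        rw [Set.sdiff_sdiff_right]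
        refine measure_union_null (hmD H hHm (hH.trans_le (min_le_left _ _))) ?_
        refine ((ha D).eq_zero_or_eq _ Set.inter_subset_right
          (hHm.inter (ha D).measurableSet)).resolve_right fun h => ?_
        exact (hH.trans_le (min_le_right _ _)).not_ge
          (h ▸ measure_mono Set.inter_subset_left)⟩) n
  have hs : ∀ n, (s (n + 1)).1 = (s n).1 \ a (s n) := fun _ => rfl
  have hdiff : ∀ n, (s n).1 \ (s (n + 1)).1 = a (s n) := fun n => by
    rw [hs, Set.sdiff_sdiff_cancel_left (haD _)]
  have hanti : Antitone fun n => (s n).1 :=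
    antitone_nat_of_succ_le fun n => by rw [hs]; exact Set.sdiff_subset
  have hmeas : ∀ n, MeasurableSet (s n).1 := fun n => (s n).2.1
  have hsub : ∀ n, ⋂ k, (s k).1 ⊆ (s n).1 := fun n => Set.iInter_subset _ n
  have hsize : Antitone fun n => μ (a (s n)) := antitone_nat_of_succ_le fun n =>
    hmax _ _ ((haD _).trans (hanti (Nat.le_succ n))) (ha _)
  have hsize0 : Tendsto (fun n => μ (a (s n))) atTop (𝓝 0) := by
    refine tendsto_of_tendsto_of_tendsto_of_le_of_le tendsto_const_nhds
      (tendsto_measure_diff_iInter (μ := μ) hmeas hanti hW) (fun n => zero_le) fun n => ?_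
    rw [← hdiff n]
    exact measure_mono (Set.sdiff_subset_sdiff_right (hsub (n + 1)))
  have hnull : ∀ n H, MeasurableSet H → μ H < w → (∀ i < n, μ H < μ (a (s i))) →
      μ (H \ (s n).1) = 0 := by
    intro n H hHm hHw
    induction n with
    | zero => exact fun _ => hsmall H hHm hHw
    | succ n ih =>
      intro hi
      rw [hs, Set.sdiff_sdiff_right]
      refine measure_union_null (ih fun i hin => hi i (by omega)) ?_
      refine ((ha (s n)).eq_zero_or_eq _ Set.inter_subset_right
        (hHm.inter (ha (s n)).measurableSet)).resolve_right fun h => ?_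
      exact (hi n (Nat.lt_succ_self n)).not_ge (h ▸ measure_mono Set.inter_subset_left)
  have hlim : Tendsto (fun n => μ (s n).1) atTop (𝓝 0) := by
    refine tendsto_measure_of_iInter_null hmeas hanti hW ?_
    by_contra h0
    obtain ⟨b, hb, hba⟩ := hat _ (.iInter hmeas) (pos_iff_ne_zero.2 h0)
      (ne_top_of_le_ne_top hW (measure_mono (hsub 0)))
    exact hba.pos.not_ge (ge_of_tendsto' hsize0 fun n => hmax (s n) b (hb.trans (hsub n)) hba)
  obtain ⟨N, hN⟩ := eventually_atTop.1 (hsize0.eventually_lt_const hw)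
  refine ⟨fun n => (s (n + N)).1, fun n => hmeas _, fun i j hij => hanti (by omega),
    ne_top_of_le_ne_top hW (measure_mono (s (0 + N)).2.2.1),
    hlim.comp (tendsto_add_atTop_nat N), fun n => ?_, fun n => ?_⟩
  · rw [Nat.add_right_comm, hdiff]
    exact (ha _).pos
  · rw [Nat.add_right_comm, hdiff]
    -- Any measure below that of the current atom is attained by some `H`, which is too small to
    -- contain this atom or an earlier one. So `H` lies almost inside the next set of the tower.
    refine le_of_forall_lt fun t ht => ?_
    obtain ⟨t', ht', ht''⟩ := exists_between ht
    obtain ⟨H, hHm, rfl⟩ := exists_measure_eq hμ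
      (ht''.le.trans (measure_mono (Set.subset_univ (a (s (n + N))))))
    refine ht'.trans_le (measure_mono_ae (ae_le_set.2 (hnull (n + N + 1) H hHm
      (ht''.trans (hN _ (by omega))) fun i hi => ht''.trans_le (hsize (by omega)))))

/-- If `[w, 2w]` were missed off `U`, the sets off `U` of measure below `w` would be closed under
unions. The union realising their supremum could still be enlarged by a small set given by `hrich`.
-/
lemma exists_measure_mem_Icc
    (hrich : ∀ W, MeasurableSet W → μ W ≠ ∞ → ∀ w > 0, ∃ H, MeasurableSet H ∧ μ H < w ∧
      μ (H \ W) ≠ 0)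
    {U : Set Ω} (hUm : MeasurableSet U) (hU : μ U ≠ ∞) {w : ℝ≥0∞} (hw : 0 < w) (hw' : w ≠ ∞) :
    ∃ E, MeasurableSet E ∧ Disjoint U E ∧ w ≤ μ E ∧ μ E ≤ 2 * w := by
  by_contra! hcon
  have hlt : ∀ E, MeasurableSet E → Disjoint U E → μ E ≤ 2 * w → μ E < w := by
    intro E hEm hE hE2
    by_contra h
    exact (hcon E hEm hE (not_lt.1 h)).not_ge hE2
  let F : Set (Set Ω) := {E | MeasurableSet E ∧ Disjoint U E ∧ μ E < w}
  obtain ⟨V, -, hVF, hV⟩ := exists_iUnion_eq_sSup μ (F := F) ⟨∅, .empty, by simp, by simpa⟩ (by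
    rintro A ⟨hAm, hA, hAw⟩ B ⟨hBm, hB, hBw⟩
    refine ⟨hAm.union hBm, hA.union_right hB, hlt _ (hAm.union hBm) (hA.union_right hB) ?_⟩
    exact (measure_union_le _ _).trans (by rw [two_mul]; gcongr))
  have hVm : MeasurableSet (⋃ n, V n) := .iUnion fun n => (hVF n).1
  have hVw : μ (⋃ n, V n) ≤ w := by
    rw [hV]
    refine sSup_le ?_
    rintro _ ⟨E, hE, rfl⟩
    exact hE.2.2.le
  have hVfin : μ (⋃ n, V n) ≠ ∞ := ne_top_of_le_ne_top hw' hVw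
  have hVU : Disjoint U (⋃ n, V n) := Set.disjoint_iUnion_right.2 fun n => (hVF n).2.1
  obtain ⟨H, hHm, hHw, hH⟩ := hrich _ (hUm.union hVm)
    ((measure_union_le _ _).trans_lt (ENNReal.add_lt_top.2 ⟨hU.lt_top, hVfin.lt_top⟩)).ne w hw
  have hHm' := hHm.diff (hUm.union hVm)
  set H' := H \ (U ∪ ⋃ n, V n)
  have hdisj : Disjoint (U ∪ ⋃ n, V n) H' := Set.disjoint_sdiff_right
  rw [Set.disjoint_union_left] at hdisj
  have hmem : (⋃ n, V n) ∪ H' ∈ F := by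
    refine ⟨hVm.union hHm', hVU.union_right hdisj.1, hlt _ (hVm.union hHm')
      (hVU.union_right hdisj.1) ((measure_union_le _ _).trans ?_)⟩
    rw [two_mul]
    exact add_le_add hVw ((measure_mono Set.sdiff_subset).trans hHw.le)
  have hle : μ ((⋃ n, V n) ∪ H') ≤ μ (⋃ n, V n) := by
    rw [hV]
    exact le_sSup ⟨_, hmem, rfl⟩
  rw [measure_union hdisj.2 hHm'] at hle
  exact (ENNReal.lt_add_right hVfin hH).not_ge hle

lemma tsum_two_thirds_pow (n : ℕ) :
    ∑' k, (2 / 3 : ℝ≥0∞) ^ (n + k) = (2 / 3) ^ n * 3 := by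
  simp_rw [pow_add]
  rw [ENNReal.tsum_mul_left, ENNReal.tsum_geometric]
  congr 1
  have h : (1 : ℝ≥0∞) - 2 / 3 = 3⁻¹ := by
    refine ENNReal.sub_eq_of_eq_add (ENNReal.div_ne_top (by simp) (by simp)) ?_
    rw [← one_div, ENNReal.div_add_div_same]
    norm_num
    exact (ENNReal.div_self (by simp) (by simp)).symm
  rw [h, inv_inv]

lemma exists_fillingTower_of_rich
    (hrich : ∀ W, MeasurableSet W → μ W ≠ ∞ → ∀ w > 0, ∃ H, MeasurableSet H ∧ μ H < w ∧
      μ (H \ W) ≠ 0) : ∃ D, IsFillingTower μ D := by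
  -- Layers get measures between `r ^ n` and `2 * r ^ n`. The ratio `r = 2 / 3` solves `r / (1 - r)
  -- = 2`, so the later lower bounds add up to the upper bound of each layer.
  have hw0 : ∀ n, 0 < (2 / 3 : ℝ≥0∞) ^ n := fun n =>
    ENNReal.pow_pos (ENNReal.div_pos (by simp) (by simp)) n
  have hwt : ∀ n, (2 / 3 : ℝ≥0∞) ^ n ≠ ∞ := fun n =>
    ENNReal.pow_ne_top (ENNReal.div_ne_top (by simp) (by simp))
  have hstep := fun (n : ℕ) (U : {U : Set Ω // MeasurableSet U ∧ μ U ≠ ∞}) =>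
    exists_measure_mem_Icc hrich U.2.1 U.2.2 (hw0 n) (hwt n)
  choose E hEm hEd hE1 hE2 using hstep
  let s : ℕ → {U : Set Ω // MeasurableSet U ∧ μ U ≠ ∞} := fun n =>
    Nat.rec ⟨∅, .empty, by simp⟩ (fun n U => ⟨U.1 ∪ E n U, U.2.1.union (hEm n U), by
      refine ((measure_union_le _ _).trans_lt (ENNReal.add_lt_top.2 ⟨U.2.2.lt_top, ?_⟩)).ne
      exact (hE2 n U).trans_lt (ENNReal.mul_lt_top (by simp) (hwt n).lt_top)⟩) n
  have hs : ∀ n, (s (n + 1)).1 = (s n).1 ∪ E n (s n) := fun _ => rfl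
  have hmeas : ∀ n, MeasurableSet (s n).1 := fun n => (s n).2.1
  have hmono : Monotone fun n => (s n).1 :=
    monotone_nat_of_le_succ fun n => by rw [hs]; exact Set.subset_union_left
  have hV : ∀ n k, (s (n + (k + 1))).1 \ (s n).1
      = ((s (n + k)).1 \ (s n).1) ∪ E (n + k) (s (n + k)) := by
    intro n k
    rw [← add_assoc, hs, Set.union_sdiff_distrib, (((hEd (n + k) _).mono_left
      (hmono (Nat.le_add_right n k))).symm).sdiff_eq_left]
  have hVμ : ∀ n k, μ ((s (n + (k + 1))).1 \ (s n).1)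
      = μ ((s (n + k)).1 \ (s n).1) + μ (E (n + k) (s (n + k))) := by
    intro n k
    rw [hV, measure_union ((hEd _ _).mono_left Set.sdiff_subset) (hEm _ _)]
  have hlow : ∀ n k, ∑ i ∈ Finset.range k, (2 / 3 : ℝ≥0∞) ^ (n + i)
      ≤ μ ((s (n + k)).1 \ (s n).1) := by
    intro n k
    induction k with
    | zero => simp
    | succ k ih =>
      rw [Finset.sum_range_succ, hVμ]
      exact add_le_add ih (hE1 _ _)
  have hupp : ∀ n k, μ ((s (n + k)).1 \ (s n).1)
      ≤ 2 * ∑ i ∈ Finset.range k, (2 / 3 : ℝ≥0∞) ^ (n + i) := by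
    intro n k
    induction k with
    | zero => simp
    | succ k ih =>
      rw [Finset.sum_range_succ, hVμ, mul_add]
      exact add_le_add ih (hE2 _ _)
  let D : ℕ → Set Ω := fun n => (⋃ k, (s k).1) \ (s n).1
  have hD : ∀ n, μ (D n) = ⨆ k, μ ((s (n + k)).1 \ (s n).1) := by
    intro n
    have : D n = ⋃ k, ((s (n + k)).1 \ (s n).1) := by
      simp only [D]
      rw [← Set.iUnion_sdiff]
      congr 1
      exact (hmono.iUnion_nat_add n).symm.trans (by simp_rw [add_comm])
    rw [this]
    refine Monotone.measure_iUnion fun i j hij => ?_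
    exact Set.sdiff_subset_sdiff_left (hmono (by omega))
  have hDlow : ∀ n, (2 / 3 : ℝ≥0∞) ^ n * 3 ≤ μ (D n) := by
    intro n
    rw [← tsum_two_thirds_pow, ENNReal.tsum_eq_iSup_nat, hD]
    exact iSup_mono (hlow n)
  have hDupp : ∀ n, μ (D n) ≤ 2 * ((2 / 3 : ℝ≥0∞) ^ n * 3) := by
    intro n
    rw [hD, ← tsum_two_thirds_pow]
    refine iSup_le fun k => (hupp n k).trans ?_
    gcongr
    exact ENNReal.sum_le_tsum _
  have hdiff : ∀ n, D n \ D (n + 1) = E n (s n) := by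
    intro n
    simp only [D]
    rw [sdiff_sdiff_sdiff_cancel_left (show (s (n + 1)).1 ≤ ⋃ k, (s k).1 from
      Set.subset_iUnion (fun k => (s k).1) (n + 1)), hs, Set.union_sdiff_left, (hEd n _).symm.sdiff_eq_left]
  refine ⟨D, fun n => (MeasurableSet.iUnion hmeas).diff (hmeas n),
    fun i j hij => Set.sdiff_subset_sdiff_right (hmono hij), ?_, ?_, fun n => ?_, fun n => ?_⟩
  · refine ne_top_of_le_ne_top ?_ (hDupp 0)
    exact ENNReal.mul_ne_top (by simp) (ENNReal.mul_ne_top (hwt 0) (by simp))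
  · refine tendsto_of_tendsto_of_tendsto_of_le_of_le tendsto_const_nhds ?_ (fun n => zero_le)
      hDupp
    have h1 : Tendsto (fun n => (2 / 3 : ℝ≥0∞) ^ n) atTop (𝓝 0) :=
      ENNReal.tendsto_pow_atTop_nhds_zero_of_lt_one
        ((ENNReal.div_lt_iff (by simp) (by simp)).2 (by norm_num))
    have h2 := ENNReal.Tendsto.const_mul (a := 2)
      (ENNReal.Tendsto.mul_const (b := 3) h1 (Or.inr (by simp))) (Or.inr (by simp))
    simpa using h2
  · rw [hdiff]
    exact (hw0 n).trans_le (hE1 _ _)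
  · rw [hdiff]
    refine (hE2 _ _).trans (le_trans (le_of_eq ?_) (hDlow (n + 1)))
    rw [pow_succ, mul_assoc, ENNReal.div_mul_cancel (by simp) (by simp), mul_comm]

/-- A nonzero measure whose range is an interval has a filling tower. -/
theorem exists_fillingTower [SigmaFinite μ] (hμ : (measureRange μ).OrdConnected)
    (hμ0 : 0 < μ Set.univ) : ∃ D, IsFillingTower μ D := by
  -- If richness fails, all small enough sets lie almost inside one `W` of finite measure. Then
  -- either atoms occur in every non-null set of finite measure, or some such set has none.
  by_cases hrich : ∀ W, MeasurableSet W → μ W ≠ ∞ → ∀ w > 0, ∃ H, MeasurableSet H ∧ μ H < w ∧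
      μ (H \ W) ≠ 0
  · exact exists_fillingTower_of_rich hrich
  by_cases hat : ∀ E, MeasurableSet E → 0 < μ E → μ E ≠ ∞ → ∃ a ⊆ E, IsMeasureAtom μ a
  · push Not at hrich
    obtain ⟨W, hWm, hW, w, hw, hsmall⟩ := hrich
    exact exists_fillingTower_of_atoms hμ hμ0 hat hWm hW hw hsmall
  · push Not at hat
    obtain ⟨D, hDm, hD0, hD, hna⟩ := hat
    refine exists_fillingTower_of_atomless hDm hD0 hD fun E hED hEm hE0 => ?_
    by_contra! hcon
    refine hna E hED ⟨hEm, hE0, ne_top_of_le_ne_top hD (measure_mono hED), fun B hB hBm => ?_⟩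
    rcases eq_or_ne (μ B) 0 with h | h
    · exact Or.inl h
    · exact Or.inr (le_antisymm (measure_mono hB) (hcon B hB hBm (pos_iff_ne_zero.2 h)))

end Tower

/-! ### Charges that depend only on the measure, and their vanishing on small sets. -/

section LevelCharge

variable {Ω : Type*} [MeasurableSpace Ω] {μ : Measure Ω} {g : Set Ω → ℝ}

/-- A countably additive real set function on the sets of finite measure which only depends on
the measure of the set. -/
structure IsLevelCharge (μ : Measure Ω) (g : Set Ω → ℝ) : Prop where
  union : ∀ A B, MeasurableSet A → MeasurableSet B → μ A ≠ ∞ → μ B ≠ ∞ → Disjoint A B →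
    g (A ∪ B) = g A + g B
  tendsto : ∀ U : ℕ → Set Ω, (∀ n, MeasurableSet (U n)) → Monotone U → μ (⋃ n, U n) ≠ ∞ →
    Tendsto (fun n => g (U n)) atTop (𝓝 (g (⋃ n, U n)))
  congr : ∀ A B, MeasurableSet A → MeasurableSet B → μ A = μ B → μ A ≠ ∞ → g A = g B

namespace IsLevelCharge

lemma empty (hg : IsLevelCharge μ g) : g ∅ = 0 := by
  have h := hg.union ∅ ∅ .empty .empty (by simp) (by simp) (by simp)
  rw [Set.union_self] at h
  linarith

lemma null (hg : IsLevelCharge μ g) {A : Set Ω} (hA : MeasurableSet A) (h : μ A = 0) :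
    g A = 0 := by
  rw [hg.congr A ∅ hA .empty (by simp [h]) (by simp [h]), hg.empty]

lemma add_mul_real (hg : IsLevelCharge μ g) (c : ℝ) :
    IsLevelCharge μ fun A => g A + c * μ.real A where
  union A B hA hB hA' hB' hd := by
    rw [hg.union A B hA hB hA' hB' hd, measureReal_union hd hB hA' hB']
    ring
  tendsto U hU hm hfin := by
    refine (hg.tendsto U hU hm hfin).add (Tendsto.const_mul c ?_)
    exact (ENNReal.tendsto_toReal hfin).comp (tendsto_measure_iUnion_atTop hm)
  congr A B hA hB h h' := by
    rw [hg.congr A B hA hB h h', measureReal_def, measureReal_def, h]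

lemma real (μ : Measure Ω) : IsLevelCharge μ μ.real := by
  have h0 : IsLevelCharge μ fun _ => 0 := ⟨by simp, by simp, by simp⟩
  simpa using h0.add_mul_real 1

/-- Countable additivity along a tower. -/
lemma hasSum_indicator (hg : IsLevelCharge μ g) {D : ℕ → Set Ω} (hD : IsFillingTower μ D)
    (h0 : ∀ n, 0 ≤ g (D n \ D (n + 1))) (A : Set ℕ) :
    HasSum (A.indicator fun n => g (D n \ D (n + 1))) (g (⋃ n ∈ A, D n \ D (n + 1))) := by
  classical
  let U : ℕ → Set Ω := fun k => ⋃ n ∈ A ∩ Set.Iio k, D n \ D (n + 1)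
  have hEm : ∀ n, MeasurableSet (D n \ D (n + 1)) := fun n =>
    (hD.measurableSet n).diff (hD.measurableSet _)
  have hUm : ∀ k, MeasurableSet (U k) := fun k =>
    .biUnion (Set.to_countable _) fun n _ => hEm n
  have hsub : ∀ B : Set ℕ, ⋃ n ∈ B, D n \ D (n + 1) ⊆ D 0 := fun B =>
    Set.iUnion₂_subset fun n _ => Set.sdiff_subset.trans (hD.antitone (Nat.zero_le n))
  have hfin : ∀ B : Set Ω, B ⊆ D 0 → μ B ≠ ∞ := fun B hB =>
    ne_top_of_le_ne_top hD.ne_top (measure_mono hB)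
  have hUunion : ⋃ k, U k = ⋃ n ∈ A, D n \ D (n + 1) := by
    ext x
    simp only [U, Set.mem_iUnion, Set.mem_inter_iff, Set.mem_Iio, exists_prop]
    exact ⟨fun ⟨_, n, hn, hx⟩ => ⟨n, hn.1, hx⟩,
      fun ⟨n, hn, hx⟩ => ⟨n + 1, n, ⟨hn, Nat.lt_succ_self n⟩, hx⟩⟩
  have hUmono : Monotone U := fun i j hij =>
    Set.biUnion_subset_biUnion_left fun n hn => ⟨hn.1, lt_of_lt_of_le hn.2 hij⟩
  have hdisj : ∀ k, Disjoint (U k) (D k \ D (k + 1)) := by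
    intro k
    refine Set.disjoint_iUnion₂_left.2 fun n hn => ?_
    refine Set.disjoint_left.2 fun x hx hx' => hx.2 (hD.antitone ?_ hx'.1)
    exact hn.2
  have hstep : ∀ k, U (k + 1) = if k ∈ A then U k ∪ (D k \ D (k + 1)) else U k := by
    intro k
    ext x
    simp only [U]
    split_ifs with hk
    · simp only [Set.mem_iUnion, Set.mem_union, Set.mem_inter_iff, Set.mem_Iio, exists_prop]
      constructor
      · rintro ⟨n, ⟨hnA, hn⟩, hx⟩
        rcases (Nat.lt_succ_iff.1 hn).eq_or_lt with rfl | h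
        · exact Or.inr hx
        · exact Or.inl ⟨n, ⟨hnA, h⟩, hx⟩
      · rintro (⟨n, ⟨hnA, hn⟩, hx⟩ | hx)
        · exact ⟨n, ⟨hnA, by omega⟩, hx⟩
        · exact ⟨k, ⟨hk, by omega⟩, hx⟩
    · simp only [Set.mem_iUnion, Set.mem_inter_iff, Set.mem_Iio, exists_prop]
      constructor
      · rintro ⟨n, ⟨hnA, hn⟩, hx⟩
        refine ⟨n, ⟨hnA, ?_⟩, hx⟩
        rcases (Nat.lt_succ_iff.1 hn).eq_or_lt with rfl | h
        · exact absurd hnA hk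
        · exact h
      · rintro ⟨n, ⟨hnA, hn⟩, hx⟩
        exact ⟨n, ⟨hnA, by omega⟩, hx⟩
  have hsum : ∀ k, ∑ i ∈ Finset.range k, A.indicator (fun n => g (D n \ D (n + 1))) i
      = g (U k) := by
    intro k
    induction k with
    | zero => simp [U, hg.empty]
    | succ k ih =>
      rw [Finset.sum_range_succ, ih, hstep]
      split_ifs with hk
      · rw [hg.union _ _ (hUm k) (hEm k) (hfin _ (hsub _))
          (hfin _ (Set.sdiff_subset.trans (hD.antitone (Nat.zero_le k)))) (hdisj k),
          Set.indicator_of_mem hk]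
      · rw [Set.indicator_of_notMem hk, add_zero]
  -- Nonnegativity of the terms turns convergence of the partial sums, given by continuity along
  -- `U`, into unconditional summation.
  refine (hasSum_iff_tendsto_nat_of_nonneg
    (fun i => Set.indicator_nonneg (fun n _ => h0 n) i) _).2 ?_
  simp_rw [hsum]
  rw [← hUunion]
  refine hg.tendsto U hUm hUmono ?_
  rw [hUunion]
  exact hfin _ (hsub A)

end IsLevelCharge

lemma IsFillingTower.tailSum_eq {D : ℕ → Set Ω} (hD : IsFillingTower μ D) (n : ℕ) :
    tailSum (fun k => μ.real (D k \ D (k + 1))) n = μ.real (D n) := by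
  have hfin : ∀ k, μ (D k) ≠ ∞ := fun k =>
    ne_top_of_le_ne_top hD.ne_top (measure_mono (hD.antitone (Nat.zero_le k)))
  have hdiff : ∀ k, μ.real (D k \ D (k + 1)) = μ.real (D k) - μ.real (D (k + 1)) := fun k =>
    measureReal_sdiff (hD.antitone (Nat.le_succ k)) (hD.measurableSet _) (hfin _)
  have hsum : ∀ k, ∑ i ∈ Finset.range k, μ.real (D (i + n) \ D (i + n + 1))
      = μ.real (D n) - μ.real (D (k + n)) := by
    intro k
    induction k with
    | zero => simp
    | succ k ih =>
      rw [Finset.sum_range_succ, ih, hdiff, Nat.add_right_comm]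
      ring
  refine ((hasSum_iff_tendsto_nat_of_nonneg (fun _ => measureReal_nonneg) _).2 ?_).tsum_eq
  simp_rw [hsum]
  have h := ((ENNReal.tendsto_toReal ENNReal.zero_ne_top).comp hD.tendsto).comp
    (tendsto_add_atTop_nat n)
  simpa [Function.comp_def, measureReal_def] using h.const_sub (μ.real (D n))

/-- A set of finite measure whose measurable subsets realise all smaller measures, such that `g`
vanishes on the sets of at most that measure. -/
structure IsZeroFilling (μ : Measure Ω) (g : Set Ω → ℝ) (G : Set Ω) : Prop where
  measurableSet : MeasurableSet G
  ne_top : μ G ≠ ∞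
  fill : ∀ s ≤ μ G, ∃ C ⊆ G, MeasurableSet C ∧ μ C = s
  zero : ∀ A, MeasurableSet A → μ A ≤ μ G → g A = 0

/-- After subtracting a multiple of the measure, a level charge with a lower bound on small sets
vanishes on small sets. -/
theorem exists_isZeroFilling [SigmaFinite μ] (hμ : (measureRange μ).OrdConnected)
    (hμ0 : 0 < μ Set.univ) (hg : IsLevelCharge μ g) {δ : ℝ≥0∞} (hδ : 0 < δ) {c : ℝ}
    (hpos : ∀ A, MeasurableSet A → μ A < δ → 0 ≤ g A + c * μ.real A) :
    ∃ α : ℝ, ∃ G, IsZeroFilling μ (fun A => g A + α * μ.real A) G ∧ 0 < μ G := by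
  obtain ⟨D', hD'⟩ := exists_fillingTower hμ hμ0
  -- Dropping the first `N` layers brings the whole tower below `δ`, where `g + c μ` is nonnegative.
  obtain ⟨N, hN⟩ := (hD'.tendsto.eventually_lt_const hδ).exists
  obtain ⟨D, hD, hDδ⟩ : ∃ D, IsFillingTower μ D ∧ μ (D 0) < δ :=
    ⟨_, hD'.shift N, by simpa using hN⟩
  have hEm : ∀ n, MeasurableSet (D n \ D (n + 1)) := fun n =>
    (hD.measurableSet n).diff (hD.measurableSet _)
  have hE0 : ∀ n, D n \ D (n + 1) ⊆ D 0 := fun n =>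
    Set.sdiff_subset.trans (hD.antitone (Nat.zero_le n))
  have hfin : ∀ B : Set Ω, B ⊆ D 0 → μ B ≠ ∞ := fun B hB =>
    ne_top_of_le_ne_top hD.ne_top (measure_mono hB)
  have hSm : ∀ A : Set ℕ, MeasurableSet (⋃ n ∈ A, D n \ D (n + 1)) := fun A =>
    .biUnion (Set.to_countable _) fun n _ => hEm n
  have hSsub : ∀ A : Set ℕ, ⋃ n ∈ A, D n \ D (n + 1) ⊆ D 0 := fun A =>
    Set.iUnion₂_subset fun n _ => hE0 n
  have hx := (IsLevelCharge.real μ).hasSum_indicator hD (fun _ => measureReal_nonneg)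
  set x : ℕ → ℝ := fun n => μ.real (D n \ D (n + 1)) with hxdef
  have hg' := hg.add_mul_real c
  have hy0 : ∀ n, 0 ≤ g (D n \ D (n + 1)) + c * μ.real (D n \ D (n + 1)) := fun n =>
    hpos _ (hEm n) ((measure_mono (hE0 n)).trans_lt hDδ)
  have hy := hg'.hasSum_indicator hD hy0
  set y : ℕ → ℝ := fun n => g (D n \ D (n + 1)) + c * μ.real (D n \ D (n + 1)) with hydef
  have hxs : Summable x := by simpa using (hx Set.univ).summable
  have hys : Summable y := by simpa using (hy Set.univ).summable
  have hx0 : ∀ n, 0 < x n := fun n => ENNReal.toReal_pos (hD.pos n).ne' (hfin _ (hE0 n))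
  have hxfill : ∀ n, x n ≤ tailSum x (n + 1) := by
    intro n
    rw [hD.tailSum_eq]
    exact ENNReal.toReal_mono (hfin _ (hD.antitone (Nat.zero_le _))) (hD.le n)
  obtain ⟨α, hα⟩ := exists_eq_mul_of_subsum_congr hxs hx0 hxfill hys hy0 (fun A B hAB => by
    have hA : subsum y A = _ := (hy A).tsum_eq
    have hB : subsum y B = _ := (hy B).tsum_eq
    have hA' : subsum x A = _ := (hx A).tsum_eq
    have hB' : subsum x B = _ := (hx B).tsum_eq
    rw [hA, hB]
    refine hg'.congr _ _ (hSm A) (hSm B) ?_ (hfin _ (hSsub A))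
    rw [hA', hB'] at hAB
    exact (ENNReal.toReal_eq_toReal_iff' (hfin _ (hSsub A)) (hfin _ (hSsub B))).1 hAB)
  have hfill : ∀ s ≤ μ (D 0), ∃ A : Set ℕ, μ (⋃ n ∈ A, D n \ D (n + 1)) = s := by
    intro s hs
    obtain ⟨A, -, hA⟩ := exists_subsum_eq hxs (fun n => (hx0 n).le) hxfill (n := 0)
      (t := s.toReal) ENNReal.toReal_nonneg (by
        rw [hD.tailSum_eq]
        exact ENNReal.toReal_mono hD.ne_top hs)
    refine ⟨A, (ENNReal.toReal_eq_toReal_iff' (hfin _ (hSsub A))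
      (ne_top_of_le_ne_top hD.ne_top hs)).1 ?_⟩
    rw [← hA]
    exact (hx A).tsum_eq.symm
  have hg'' := hg.add_mul_real (c - α)
  have hzero : ∀ n, g (D n \ D (n + 1)) + (c - α) * μ.real (D n \ D (n + 1)) = 0 := by
    intro n
    have h := hα n
    simp only [hxdef, hydef] at h
    linarith
  refine ⟨c - α, D 0, ⟨hD.measurableSet 0, hD.ne_top, fun s hs => ?_, fun A hA hA0 => ?_⟩,
    (hD.pos 0).trans_le (measure_mono (hE0 0))⟩
  · obtain ⟨A, hA⟩ := hfill s hs
    exact ⟨_, hSsub A, hSm A, hA⟩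
  -- A union of layers has the same measure as `A`, and the corrected charge vanishes on each layer.
  · obtain ⟨B, hB⟩ := hfill _ hA0
    have h := hg''.hasSum_indicator hD (fun n => (hzero n).ge) B
    simp_rw [hzero] at h
    rw [Set.indicator_zero] at h
    exact (hg''.congr _ _ hA (hSm B) hB.symm (hB ▸ hfin _ (hSsub B))).trans
      (h.unique hasSum_zero)

end LevelCharge

/-! ### Propagation from small sets to all sets of finite measure. -/

section Extension

variable {Ω : Type*} [MeasurableSpace Ω] {μ : Measure Ω} {g : Set Ω → ℝ}

/-- A measure `s` above `μ G` is also at least `μ E`, so it is attained by `E` together with a part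
of `G` of measure `s - μ E`; the charge vanishes on both. -/
lemma IsZeroFilling.union_of_disjoint (hg : IsLevelCharge μ g) {G E : Set Ω}
    (hG : IsZeroFilling μ g G) (hE : MeasurableSet E) (hd : Disjoint G E) (hle : μ E ≤ μ G) :
    IsZeroFilling μ g (G ∪ E) := by
  have hEfin : μ E ≠ ∞ := ne_top_of_le_ne_top hG.ne_top hle
  have hμ : μ (G ∪ E) = μ G + μ E := measure_union hd hE
  have hfill : ∀ s ≤ μ (G ∪ E), ∃ C ⊆ G ∪ E, MeasurableSet C ∧ μ C = s ∧ g C = 0 := by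
    intro s hs
    rcases le_total s (μ G) with h | h
    · obtain ⟨C, hC, hCm, rfl⟩ := hG.fill s h
      exact ⟨C, hC.trans Set.subset_union_left, hCm, rfl, hG.zero C hCm h⟩
    · obtain ⟨C, hC, hCm, hCs⟩ := hG.fill (s - μ E) (by
        rw [tsub_le_iff_right, ← hμ]; exact hs)
      have hdC : Disjoint C E := hd.mono_left hC
      refine ⟨C ∪ E, Set.union_subset_union_left E hC, hCm.union hE, ?_, ?_⟩
      · rw [measure_union hdC hE, hCs, tsub_add_cancel_of_le (hle.trans h)]
      · rw [hg.union C E hCm hE (ne_top_of_le_ne_top hG.ne_top (measure_mono hC)) hEfin hdC,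
          hG.zero C hCm (measure_mono hC), hG.zero E hE hle, add_zero]
  refine ⟨hG.measurableSet.union hE, ?_, fun s hs => ?_, fun A hA hAG => ?_⟩
  · rw [hμ]
    exact ENNReal.add_ne_top.2 ⟨hG.ne_top, hEfin⟩
  · obtain ⟨C, hC, hCm, hCs, -⟩ := hfill s hs
    exact ⟨C, hC, hCm, hCs⟩
  · obtain ⟨C, -, hCm, hCs, hC0⟩ := hfill _ hAG
    rw [← hC0]
    refine hg.congr A C hA hCm hCs.symm (ne_top_of_le_ne_top ?_ hAG)
    rw [hμ]
    exact ENNReal.add_ne_top.2 ⟨hG.ne_top, hEfin⟩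

lemma IsZeroFilling.union (hg : IsLevelCharge μ g) {G G' : Set Ω}
    (hG : IsZeroFilling μ g G) (hG' : IsZeroFilling μ g G') : IsZeroFilling μ g (G ∪ G') := by
  wlog h : μ G' ≤ μ G generalizing G G'
  · rw [Set.union_comm]
    exact this hG' hG (not_le.1 h).le
  rw [← Set.union_sdiff_self]
  exact hG.union_of_disjoint hg (hG'.measurableSet.diff hG.measurableSet)
    Set.disjoint_sdiff_right ((measure_mono Set.sdiff_subset).trans h)

/-- The union of a sequence approaching the supremum either has infinite measure, which settles
every finite one, or is itself zero filling and cannot be enlarged. -/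
lemma exists_maximal_isZeroFilling (hg : IsLevelCharge μ g) {G₀ : Set Ω}
    (hG₀ : IsZeroFilling μ g G₀) :
    (∀ A, MeasurableSet A → μ A ≠ ∞ → g A = 0) ∨
    ∃ G, IsZeroFilling μ g G ∧ μ G₀ ≤ μ G ∧
      ∀ E, MeasurableSet E → Disjoint G E → μ E ≤ μ G → μ E = 0 := by
  obtain ⟨U, hU, hUF, hUμ⟩ := exists_iUnion_eq_sSup μ (F := {G | IsZeroFilling μ g G}) ⟨G₀, hG₀⟩
    fun A hA B hB => hA.union hg hB
  have hlt : ∀ s < μ (⋃ n, U n), ∃ n, s < μ (U n) := fun s hs => by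
    rwa [hU.measure_iUnion, lt_iSup_iff] at hs
  by_cases hfin : μ (⋃ n, U n) = ∞
  · left
    intro A hA hAfin
    obtain ⟨n, hn⟩ := hlt (μ A) (by rw [hfin]; exact hAfin.lt_top)
    exact (hUF n).zero A hA hn.le
  right
  have hm : MeasurableSet (⋃ n, U n) := .iUnion fun n => (hUF n).measurableSet
  have hG : IsZeroFilling μ g (⋃ n, U n) := by
    refine ⟨hm, hfin, fun s hs => ?_, fun A hA hAG => ?_⟩
    · rcases hs.eq_or_lt with rfl | hs
      · exact ⟨_, subset_rfl, hm, rfl⟩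
      · obtain ⟨n, hn⟩ := hlt s hs
        obtain ⟨C, hC, h⟩ := (hUF n).fill s hn.le
        exact ⟨C, hC.trans (Set.subset_iUnion U n), h⟩
    · rcases hAG.eq_or_lt with h | h
      · rw [hg.congr A _ hA hm h (h ▸ hfin)]
        refine tendsto_nhds_unique
          (hg.tendsto U (fun n => (hUF n).measurableSet) hU hfin) ?_
        simp [fun n => (hUF n).zero (U n) (hUF n).measurableSet le_rfl]
      · obtain ⟨n, hn⟩ := hlt _ h
        exact (hUF n).zero A hA hn.le
  refine ⟨_, hG, ?_, fun E hE hd hle => ?_⟩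
  · rw [hUμ]
    exact le_sSup ⟨G₀, hG₀, rfl⟩
  · have h : μ ((⋃ n, U n) ∪ E) ≤ μ (⋃ n, U n) :=
      hUμ.ge.trans' (le_sSup ⟨_, hG.union_of_disjoint hg hE hd hle, rfl⟩)
    rw [measure_union hd hE] at h
    by_contra h0
    exact (ENNReal.lt_add_right hfin h0).not_ge h

/-- A level charge vanishing on small sets vanishes on all sets of finite measure. -/
theorem IsZeroFilling.eq_zero (hμ : (measureRange μ).OrdConnected) (hg : IsLevelCharge μ g)
    {G₀ : Set Ω} (hG₀ : IsZeroFilling μ g G₀) (hpos : 0 < μ G₀) {A : Set Ω}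
    (hA : MeasurableSet A) (hAfin : μ A ≠ ∞) : g A = 0 := by
  obtain hall | ⟨G, hG, hG₀G, hmax⟩ := exists_maximal_isZeroFilling hg hG₀
  · exact hall A hA hAfin
  have hτ0 : μ G ≠ 0 := (hpos.trans_le hG₀G).ne'
  have hGm := hG.measurableSet
  by_cases hout : ∀ H, MeasurableSet H → μ H ≠ ∞ → μ (H \ G) = 0
  · exact hG.zero A hA (measure_mono_ae (ae_le_set.2 (hout A hA hAfin)))
  push Not at hout
  obtain ⟨H, hHm, hH, hH0⟩ := hout
  have hbig : ∀ E, MeasurableSet E → Disjoint G E → μ E ≠ 0 → μ G < μ E := fun E hE hd h0 =>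
    not_le.1 fun h => h0 (hmax E hE hd h)
  -- A set `K` of measure slightly above `μ G` exists by the interval range. Its part off `G` is
  -- non-null, hence larger than `μ G` by `hbig`.
  have hsmall : ∀ s, μ G < s → ∃ P, MeasurableSet P ∧ Disjoint G P ∧ μ G < μ P ∧ μ P < s := by
    intro s hs
    have hGH : μ G < μ H :=
      (hbig _ (hHm.diff hGm) Set.disjoint_sdiff_right hH0).trans_le (measure_mono Set.sdiff_subset)
    obtain ⟨t, ht, hts⟩ := exists_between (lt_min hs hGH)
    obtain ⟨K, hKm, rfl⟩ := exists_measure_eq hμ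
      ((hts.trans_le (min_le_right _ _)).le.trans (measure_mono (Set.subset_univ H)))
    refine ⟨K \ G, hKm.diff hGm, Set.disjoint_sdiff_right, ?_, ?_⟩
    · refine hbig _ (hKm.diff hGm) Set.disjoint_sdiff_right fun h => ?_
      exact ht.not_ge (measure_mono_ae (ae_le_set.2 h))
    · exact (measure_mono Set.sdiff_subset).trans_lt (hts.trans_le (min_le_left _ _))
  -- Two non-null pieces off `G` would have total measure above `2 * μ G`, so `P` behaves like an
  -- atom.
  have haed : ∀ P Q, MeasurableSet P → MeasurableSet Q → Disjoint G P → Disjoint G Q →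
      μ Q < μ P → μ P < 2 * μ G → AEDisjoint μ P Q := by
    intro P Q hP hQ hdP hdQ hQP hP2
    by_contra h0
    have h1 := hbig _ (hP.inter hQ) (hdP.mono_right Set.inter_subset_left) h0
    have h2 : μ (P \ Q) = 0 := by
      by_contra h0'
      have h2 := hbig _ (hP.diff hQ) (hdP.mono_right Set.sdiff_subset) h0'
      refine hP2.not_ge ?_
      rw [← measure_inter_add_sdiff P hQ, two_mul]
      exact add_le_add h1.le h2.le
    exact hQP.not_ge (measure_mono_ae (ae_le_set.2 h2))
  have hconst : ∀ P Q, MeasurableSet P → MeasurableSet Q → Disjoint G P → Disjoint G Q →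
      μ G < μ P → μ P < 2 * μ G → μ G < μ Q → μ Q < 2 * μ G → g P = g Q := by
    intro P Q hP hQ hdP hdQ hP1 hP2 hQ1 hQ2
    wlog h : μ Q ≤ μ P generalizing P Q
    · exact (this Q P hQ hP hdQ hdP hQ1 hQ2 hP1 hP2 (not_le.1 h).le).symm
    obtain ⟨C, hC, hCm, hCs⟩ := hG.fill (μ P - μ Q) (by
      rw [tsub_le_iff_right]
      exact (hP2.le.trans (two_mul _).le).trans (by gcongr))
    have hd : Disjoint Q C := (hdQ.mono_left hC).symm
    have hPfin : μ P ≠ ∞ := hP2.ne_top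
    have hCG : μ C ≤ μ G := measure_mono hC
    rw [hg.congr P (Q ∪ C) hP (hQ.union hCm)
      (by rw [measure_union hd hCm, hCs, add_tsub_cancel_of_le h]) hPfin,
      hg.union Q C hQ hCm hQ2.ne_top (ne_top_of_le_ne_top hG.ne_top hCG) hd,
      hG.zero C hCm hCG, add_zero]
  have hτ2 : μ G < 2 * μ G := by
    rw [two_mul]; exact ENNReal.lt_add_right hG.ne_top hτ0
  obtain ⟨P₀, hP₀m, hP₀d, hP₀1, hP₀2⟩ := hsmall _ hτ2
  -- `U` consists of a part of `G` and `k` such atoms, all of measure below `b`. In the induction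
  -- the new atom `P` becomes the next bound, so the atoms used have distinct measures and are
  -- almost disjoint.
  have hind : ∀ (k : ℕ) (t b : ℝ≥0∞), k * μ G < t → t ≤ (k + 1) * μ G → μ G < b → b ≤ 2 * μ G →
      ∃ U, MeasurableSet U ∧ μ U = t ∧ g U = k * g P₀ ∧
        ∀ P, MeasurableSet P → Disjoint G P → b ≤ μ P → μ P < 2 * μ G → AEDisjoint μ U P := by
    intro k
    induction k with
    | zero =>
      intro t b _ ht _ _
      obtain ⟨C, hC, hCm, hCt⟩ := hG.fill t (by simpa using ht)
      exact ⟨C, hCm, hCt, by simpa using hG.zero C hCm (measure_mono hC),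
        fun P _ hd _ _ => (hd.mono_left hC).aedisjoint⟩
    | succ k ih =>
      intro t b ht1 ht2 hb1 hb2
      push_cast at ht1 ht2 ⊢
      obtain ⟨P, hPm, hPd, hP1, hP2⟩ := hsmall (min b (t - k * μ G))
        (lt_min hb1 (lt_tsub_iff_left.2 (by rwa [add_mul, one_mul] at ht1)))
      have hPb := hP2.trans_le (min_le_left _ _)
      have hPt := hP2.trans_le (min_le_right _ _)
      have hPt' : μ P ≤ t := hPt.le.trans tsub_le_self
      obtain ⟨U, hUm, hUt, hUg, hU⟩ := ih (t - μ P) (μ P)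
        (lt_tsub_comm.1 hPt) (by
          rw [tsub_le_iff_right]
          refine ht2.trans ?_
          rw [add_mul _ 1 (μ G), one_mul]
          gcongr) hP1 (hPb.le.trans hb2)
      have hP2' := hPb.trans_le hb2
      have hnull : μ (P \ U) = μ P := by
        refine le_antisymm (measure_mono Set.sdiff_subset) (measure_mono_ae ?_)
        refine ae_le_set.2 ?_
        rw [sdiff_sdiff_right_self]
        have := hU P hPm hPd le_rfl hP2'
        rwa [AEDisjoint, Set.inter_comm] at this
      have hUfin : μ U ≠ ∞ := by
        rw [hUt]
        refine ne_top_of_le_ne_top ?_ (tsub_le_self.trans ht2)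
        exact ENNReal.mul_ne_top (by simp) hG.ne_top
      refine ⟨U ∪ (P \ U), hUm.union (hPm.diff hUm), ?_, ?_, fun Q hQ hdQ hbQ hQ2 => ?_⟩
      · rw [measure_union Set.disjoint_sdiff_right (hPm.diff hUm), hnull, hUt,
          tsub_add_cancel_of_le hPt']
      · rw [hg.union U (P \ U) hUm (hPm.diff hUm) hUfin (by rw [hnull]; exact hP2'.ne_top)
          Set.disjoint_sdiff_right, hUg, hg.congr (P \ U) P (hPm.diff hUm) hPm hnull
          (by rw [hnull]; exact hP2'.ne_top),
          hconst P P₀ hPm hP₀m hPd hP₀d hP1 hP2' hP₀1 hP₀2]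
        ring
      · refine (hU Q hQ hdQ (hPb.le.trans hbQ) hQ2).union_left ?_
        exact ((haed Q P hQ hPm hdQ hPd (hPb.trans_le hbQ) hQ2).symm).mono
          Set.sdiff_subset subset_rfl
  -- The measure `μ P₀ + μ G` is attained with charge `2 * g P₀` by `hind`, and with charge `g P₀`
  -- by `P₀ ∪ G`.
  have hP₀zero : g P₀ = 0 := by
    obtain ⟨U, hUm, hUt, hUg, -⟩ := hind 2 (μ P₀ + μ G) (2 * μ G)
      (by
        push_cast
        rw [two_mul]
        exact (ENNReal.add_lt_add_iff_right hG.ne_top).2 hP₀1)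
      (by
        push_cast
        rw [add_mul, one_mul]
        gcongr) hτ2 le_rfl
    have h1 := hg.union P₀ G hP₀m hGm hP₀2.ne_top hG.ne_top hP₀d.symm
    have h2 := hg.congr U (P₀ ∪ G) hUm (hP₀m.union hGm)
      (by rw [hUt, measure_union hP₀d.symm hGm])
      (by rw [hUt]; exact ENNReal.add_ne_top.2 ⟨hP₀2.ne_top, hG.ne_top⟩)
    rw [hG.zero G hGm le_rfl] at h1
    push_cast at hUg
    linarith
  rcases eq_or_ne (μ A) 0 with h0 | h0
  · exact hg.null hA h0
  classical
  have hex : ∃ n : ℕ, μ A ≤ n * μ G :=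
    (ENNReal.exists_nat_mul_gt hτ0 hAfin).imp fun n hn => hn.le
  have hspec := Nat.find_spec hex
  have hmin := fun m => Nat.find_min hex (m := m)
  set n := Nat.find hex
  rcases n with _ | k
  · exact absurd (by simpa using hspec) h0
  obtain ⟨U, hUm, hUt, hUg, -⟩ := hind k (μ A) (2 * μ G) (not_le.1 (hmin k (Nat.lt_succ_self k)))
    (by simpa using hspec) hτ2 le_rfl
  rw [hg.congr A U hA hUm hUt.symm hAfin, hUg, hP₀zero, mul_zero]

end Extension

/-! ### Passage between the real-valued charge and `ν`. -/

section SignedMeasure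

variable {Ω : Type*} [MeasurableSpace Ω] {μ : Measure Ω} {ν : VectorMeasure Ω EReal}

lemma ConditionL.coe_toReal (hL : ConditionL μ ν) {A : Set Ω} (hA : MeasurableSet A)
    (hfin : μ A ≠ ∞) : ((ν A).toReal : EReal) = ν A :=
  EReal.coe_toReal (hL A A hA hA rfl hfin).2.1 (hL A A hA hA rfl hfin).2.2

lemma ConditionL.isLevelCharge (hL : ConditionL μ ν) :
    IsLevelCharge μ fun A => (ν A).toReal where
  union A B hA hB hA' hB' hd := by
    rw [ν.of_union hd hA hB, ← hL.coe_toReal hA hA', ← hL.coe_toReal hB hB', ← EReal.coe_add]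
    simp only [EReal.toReal_coe]
  tendsto U hU hm hfin := by
    have hi := hL _ _ (MeasurableSet.iUnion hU) (MeasurableSet.iUnion hU) rfl hfin
    exact (EReal.tendsto_toReal hi.2.1 hi.2.2).comp
      (VectorMeasure.tendsto_vectorMeasure_iUnion_atTop_nat hm hU)
  congr A B hA hB h h' := by rw [(hL A B hA hB h h').1]

/-- Proportionality on sets of finite measure extends to all measurable sets. -/
lemma eq_mul_of_eq_mul_of_ne_top [SigmaFinite μ] {α : ℝ}
    (h : ∀ A, MeasurableSet A → μ A ≠ ∞ → ν A = (α : EReal) * ((μ A : ℝ≥0∞) : EReal))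
    {A : Set Ω} (hA : MeasurableSet A) : ν A = (α : EReal) * ((μ A : ℝ≥0∞) : EReal) := by
  let U : ℕ → Set Ω := fun n => A ∩ spanningSets μ n
  have hUm : ∀ n, MeasurableSet (U n) := fun n => hA.inter (measurableSet_spanningSets μ n)
  have hU : Monotone U := fun i j hij =>
    Set.inter_subset_inter_right A (monotone_spanningSets μ hij)
  have hUA : ⋃ n, U n = A := by
    rw [← Set.inter_iUnion, iUnion_spanningSets, Set.inter_univ]
  have hfin : ∀ n, μ (U n) ≠ ∞ := fun n =>
    ((measure_mono Set.inter_subset_right).trans_lt (measure_spanningSets_lt_top μ n)).ne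
  have h1 := VectorMeasure.tendsto_vectorMeasure_iUnion_atTop_nat (v := ν) hU hUm
  have h2 : Tendsto (fun n => ((μ (U n) : ℝ≥0∞) : EReal)) atTop (𝓝 ((μ A : ℝ≥0∞) : EReal)) := by
    rw [← hUA]
    exact (continuous_coe_ennreal_ereal.tendsto _).comp (tendsto_measure_iUnion_atTop hU)
  rw [hUA] at h1
  simp_rw [fun n => h (U n) (hUm n) (hfin n)] at h1
  -- Multiplication by a finite `α` is continuous even at `⊤`, including the case `0 * ⊤ = 0`.
  exact tendsto_nhds_unique h1 (EReal.Tendsto.const_mul h2 (Or.inl (EReal.coe_ne_bot α))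
    (Or.inl (EReal.coe_ne_top α)))

end SignedMeasure

theorem proposition3p3 {Ω : Type*} [MeasurableSpace Ω] (μ : Measure Ω) [SigmaFinite μ]
    (hμ : (measureRange μ).OrdConnected)
    (ν : VectorMeasure Ω EReal) (hν : IsSigmaFiniteSignedMeasure ν)
    (hL : ConditionL μ ν)
    (h : (∀ A, MeasurableSet A → 0 ≤ ν A) ∨
      ∃ (ε M : ℝ≥0), 0 < ε ∧
        ∀ A, MeasurableSet A → 0 < μ A → μ A < ε → (ν A).abs / μ A < M) :
    ∃ α : ℝ, ∀ A, MeasurableSet A → ν A = (α : EReal) * ((μ A : ℝ≥0∞) : EReal) := by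
  have hg := hL.isLevelCharge
  suffices hreal : ∃ α : ℝ, ∀ A, MeasurableSet A → μ A ≠ ∞ → (ν A).toReal = α * μ.real A by
    obtain ⟨α, hα⟩ := hreal
    refine ⟨α, fun A hA => eq_mul_of_eq_mul_of_ne_top (fun B hB hBfin => ?_) hA⟩
    rw [← hL.coe_toReal hB hBfin, hα B hB hBfin, EReal.coe_mul, measureReal_def,
      EReal.coe_ennreal_toReal hBfin]
  rcases eq_or_ne (μ Set.univ) 0 with hμ0 | hμ0
  · refine ⟨0, fun A hA _ => ?_⟩
    rw [zero_mul]
    exact hg.null hA (measure_mono_null (Set.subset_univ A) hμ0)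
  obtain ⟨δ, hδ, c, hc⟩ : ∃ δ : ℝ≥0∞, 0 < δ ∧ ∃ c : ℝ, ∀ A, MeasurableSet A → μ A < δ →
      0 ≤ (ν A).toReal + c * μ.real A := by
    rcases h with h | ⟨ε, M, hε, hM⟩
    · exact ⟨1, one_pos, 0, fun A hA _ => by simpa using EReal.toReal_nonneg (h A hA)⟩
    · refine ⟨ε, by exact_mod_cast hε, M, fun A hA hAε => ?_⟩
      rcases eq_or_ne (μ A) 0 with h0 | h0
      · simp [hg.null hA h0, measureReal_def, h0]
      have hAfin : μ A ≠ ∞ := (hAε.trans ENNReal.coe_lt_top).ne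
      have h1 := hM A hA (pos_iff_ne_zero.2 h0) hAε
      rw [ENNReal.div_lt_iff (Or.inl h0) (Or.inl hAfin), ← hL.coe_toReal hA hAfin,
        EReal.abs_def] at h1
      have h2 := ENNReal.toReal_mono (ENNReal.mul_ne_top ENNReal.coe_ne_top hAfin) h1.le
      rw [ENNReal.toReal_ofReal (abs_nonneg _), ENNReal.toReal_mul, ENNReal.coe_toReal] at h2
      rw [measureReal_def]
      linarith [neg_abs_le (ν A).toReal]
  obtain ⟨α, G, hG, hG0⟩ := exists_isZeroFilling hμ (pos_iff_ne_zero.2 hμ0) hg hδ hc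
  refine ⟨-α, fun A hA hAfin => ?_⟩
  have := hG.eq_zero hμ (hg.add_mul_real α) hG0 hA hAfin
  linarith
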